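/- Throughout, a multigraph is finite and loopless, possibly with parallel edges, and $\mu(H)$ is the maximum size of a matching of $H$. For a multigraph $G=(V,E)$ with $n=|V|$ and $\varepsilon\in(0,\tfrac12)$, put $\alpha_\varepsilon=\log n\cdot 2^{60/\varepsilon^2}$ and $\rho_\varepsilon=\log n\cdot 2^{40/\varepsilon^2}$ (natural logarithm). Let $\kappa:E\to\mathbb{R}_{\ge 0}$ be a capacity function. For $e\in E$ let $D(e)$ be the set of all edges with the same two endpoints as $e$, and let $$E_L=\Big\{e\in E:\ \sum_{f\in D(e)}\kappa(f)\le \frac1{\alpha_\varepsilon^2}\Big\}.$$ Define $\kappa^+(e)=\alpha_\varepsilon\,\kappa(e)$ for $e\in E_L$ and $\kappa^+(e)=\kappa(e)$ for $e\in E\setminus E_L$. The bipartite double cover $\mathrm{bc}(H)$ of a multigraph $H$ has two vertices $v,v'$ for every vertex $v$ of $H$, and, for every edge $e$ of $H$ between $u$ and $v$, two edges, one between $u$ and $v'$ and one between $v$ and $u'$. A capacity function $c$ on the edges of $H$ gives the capacity function $c_{\mathrm{bc}}$ on $\mathrm{bc}(H)$ under which both copies of $e$ have capacity $c(e)$. We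 write $\mu(\mathrm{bc}(H),c_{\mathrm{bc}})$ for the maximum of $\sum_e x(e)$ over all fractional matchings $x$ of $\mathrm{bc}(H)$ (that is, $x\ge 0$ and $\sum_{e\ni w}x(e)\le 1$ for every vertex $w$) with $x\le c_{\mathrm{bc}}$. For $W\subseteq V$, $G[W]\cap E_L$ denotes the graph with vertex set $W$ whose edges are the edges of $E_L$ with both endpoints in $W$, and similarly for subgraphs of $G$. **Lemma.** Let $G$ be a multigraph on $n$ vertices, let $\varepsilon\in(0,\tfrac12)$, suppose that $\mu(G)\ge \varepsilon n/16$, and let $\kappa$ be a capacity function on the edges of $G$. Let $G_s$ be the random spanning subgraph of $G$ that contains each edge $e$ independently with probability $p(e)=\min\{1,\kappa(e)\,\rho_\varepsilon\}$. Then, with probability at least $1-\exp(-\mu(G))$, for all $W\subseteq V$ simultaneously, $$\mu\big(\mathrm{bc}(G_s[W]\cap E_L)\big)\ \le\ \mu\big(\mathrm{bc}(G[W]\cap E_L),\kappa^+_{\mathrm{bc}}\big)+\varepsilon\,\mu(G).$$ -/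

import Mathlib

open MeasureTheory ProbabilityTheory

/-! Finite multigraphs are Mathlib's `Graph α β` (vertices in `α`, edges in `β`).
`G.induce W` is `G[W]`, and `G.restrict F` keeps all vertices and exactly the edges in `F`. -/

namespace CapMatching

variable {α β : Type*}

/-- A set `M` of edges of `G` is a matching if distinct edges of `M` share no endpoint. -/
def IsMatching (G : Graph α β) (M : Set β) : Prop :=
  M ⊆ G.edgeSet ∧ ∀ e ∈ M, ∀ f ∈ M, ∀ v, G.Inc e v → G.Inc f v → e = f

/-- `μ(G)`: the size of a maximum integral matching of the finite multigraph `G`. -/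
noncomputable def matchingNumber (G : Graph α β) : ℕ :=
  sSup {k : ℕ | ∃ M : Set β, IsMatching G M ∧ M.ncard = k}

/-- A nonnegative edge vector `x` with `∑_{e ∋ v} x e ≤ 1` at every vertex `v`. -/
def IsFractionalMatching (G : Graph α β) (x : β → ℝ) : Prop :=
  (∀ e ∈ G.edgeSet, 0 ≤ x e) ∧
    ∀ v ∈ G.vertexSet, ∑ᶠ e ∈ {e | G.Inc e v}, x e ≤ 1

/-- The maximum value of a fractional matching of the finite multigraph `G` that obeys the
capacities `c`. It is applied to bipartite graphs only, where the odd set constraints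
follow from the degree constraints. -/
noncomputable def fractionalMatchingValue (G : Graph α β) (c : β → ℝ) : ℝ :=
  sSup {r : ℝ | ∃ x : β → ℝ, IsFractionalMatching G x ∧ (∀ e ∈ G.edgeSet, x e ≤ c e) ∧
    ∑ᶠ e ∈ G.edgeSet, x e = r}

/-- The bipartite double cover of a loopless multigraph. The two copies of a vertex `v` are
`Sum.inl v` and `Sum.inr v`. An edge `e` between `u` and `v` has the two copies `(e, u)`,
joining `Sum.inl u` to `Sum.inr v`, and `(e, v)`, joining `Sum.inl v` to `Sum.inr u`. -/
def doubleCover (G : Graph α β) : Graph (α ⊕ α) (β × α) where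
  vertexSet := {p | Sum.elim id id p ∈ G.vertexSet}
  IsLink d p q := ∃ v, G.IsLink d.1 d.2 v ∧
    ((p = Sum.inl d.2 ∧ q = Sum.inr v) ∨ (p = Sum.inr v ∧ q = Sum.inl d.2))
  isLink_symm := by
    rintro d -
    exact ⟨fun p q ⟨v, hv, h⟩ => ⟨v, hv, by tauto⟩⟩
  eq_or_eq_of_isLink_of_isLink := by
    rintro d x y z w ⟨v, hv, h⟩ ⟨v', hv', h'⟩
    obtain rfl : v = v' := hv.right_unique hv'
    rcases h with ⟨rfl, rfl⟩ | ⟨rfl, rfl⟩ <;> rcases h' with ⟨rfl, rfl⟩ | ⟨rfl, rfl⟩ <;> simp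
  left_mem_of_isLink := by
    rintro d p q ⟨v, hv, ⟨rfl, rfl⟩ | ⟨rfl, rfl⟩⟩
    · exact hv.left_mem
    · exact hv.right_mem

/-- The capacities on the double cover: both copies of `e` get the capacity of `e`. -/
def doubleCoverCapacity (c : β → ℝ) : β × α → ℝ := fun d => c d.1

/-- `α_ε = log n · 2 ^ (60 / ε²)`. -/
noncomputable def alphaEps (n : ℕ) (ε : ℝ) : ℝ := Real.log n * (2 : ℝ) ^ (60 / ε ^ 2)

/-- `ρ_ε = log n · 2 ^ (40 / ε²)`. -/
noncomputable def rhoEps (n : ℕ) (ε : ℝ) : ℝ := Real.log n * (2 : ℝ) ^ (40 / ε ^ 2)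

/-- `D(e)`: the set of all edges with the same two endpoints as `e`. -/
def parallelClass (G : Graph α β) (e : β) : Set β :=
  {f | ∃ u v, G.IsLink e u v ∧ G.IsLink f u v}

/-- `E_L(G, κ)`: the edges `e` with `κ(D(e)) ≤ 1 / α_ε²`, where `n = |V(G)|`. -/
def lowEdges (G : Graph α β) (κ : β → ℝ) (ε : ℝ) : Set β :=
  {e | e ∈ G.edgeSet ∧
    ∑ᶠ f ∈ parallelClass G e, κ f ≤ 1 / alphaEps G.vertexSet.ncard ε ^ 2}

open Classical in
/-- `κ⁺`: equal to `κ · α_ε` on `E_L(G, κ)` and to `κ` on the other edges. -/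
noncomputable def kappaPlus (G : Graph α β) (κ : β → ℝ) (ε : ℝ) : β → ℝ := fun e =>
  if e ∈ lowEdges G κ ε then κ e * alphaEps G.vertexSet.ncard ε else κ e

/-- The random edge set `S` contains each edge `e` of `G` independently with
probability `p e`; the sampled graph is then `G.restrict (S ω)`. -/
structure IsIndepEdgeSample {Ω : Type*} [MeasurableSpace Ω] (G : Graph α β) (p : β → ℝ)
    (P : Measure Ω) (S : Ω → Set β) : Prop where
  measurableSet_mem : ∀ e ∈ G.edgeSet, MeasurableSet {ω | e ∈ S ω}
  prob_mem : ∀ e ∈ G.edgeSet, P.real {ω | e ∈ S ω} = p e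
  indep : iIndepSet (fun e : G.edgeSet => {ω | (e : β) ∈ S ω}) P

end CapMatching

/-! Fix `W` and give the double cover of G[W] ∩ E_L the capacities κ⁺. A form of LP duality
(`exists_cut_doubleCover`) yields X, Y ⊆ W such that |W \ X| + |W \ Y| is at most the fractional
value and each vertex of either set sends capacity at most 1 into the other. A matching of the
sampled cover exceeds |W \ X| + |W \ Y| by at most twice the number of sampled edges between X and Y
(`matchingNumber_doubleCover_le`), so it is enough that few of these are sampled.

This must hold for all `W` at once. The ends of a maximum matching form a vertex cover T with |T| ≤
2μ, so every edge between X and Y has an end in Q = T ∩ X or Q = T ∩ Y, and its other end sends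
capacity at most 1 to Q. It therefore lies in `lightBoundary` of Q, a set that depends on Q alone;
only 2^|T| ≤ e^(2μ) sets Q ⊆ T occur.

A light boundary has capacity at most n ≤ 16μ/ε (`sum_lightBoundary_le`), and a low edge is sampled
with probability at most 2^(-20/ε²) κ⁺. By Chernoff, more than εμ/4 of its edges are sampled with
probability at most e^(-3μ), and the union bound over Q leaves e^(-μ). -/

namespace CapMatching

/-! ### Duality for capacitated bipartite fractional matchings -/

section Cut

variable {ι L R : Type*} [DecidableEq L] [DecidableEq R]

/-- The fractional matchings of a bipartite edge family obeying the capacities `c`. -/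
def cappedPolytope (E : Finset ι) (l : ι → L) (r : ι → R) (c : ι → ℝ) : Set (ι → ℝ) :=
  {x | (∀ e ∈ E, 0 ≤ x e ∧ x e ≤ c e) ∧ (∀ e ∉ E, x e = 0) ∧
    (∀ u, ∑ e ∈ E with l e = u, x e ≤ 1) ∧ ∀ v, ∑ e ∈ E with r e = v, x e ≤ 1}

/-- Pinning the coordinates outside `E` to zero places the polytope in a product of compact sets
even when `ι` is infinite. -/
theorem isCompact_cappedPolytope (E : Finset ι) (l : ι → L) (r : ι → R) (c : ι → ℝ) :
    IsCompact (cappedPolytope E l r c) := by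
  classical
  have hK : IsCompact (Set.univ.pi fun e => if e ∈ E then Set.Icc 0 (c e) else {(0 : ℝ)}) := by
    refine isCompact_univ_pi fun e => ?_
    split_ifs
    · exact isCompact_Icc
    · exact isCompact_singleton
  refine hK.of_isClosed_subset ?_ ?_
  · have : cappedPolytope E l r c =
        (⋂ e ∈ E, {x | 0 ≤ x e ∧ x e ≤ c e}) ∩ (⋂ e ∈ {e | e ∉ E}, {x | x e = 0}) ∩
        (⋂ u, {x | ∑ e ∈ E with l e = u, x e ≤ 1}) ∩
        (⋂ v, {x | ∑ e ∈ E with r e = v, x e ≤ 1}) := by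
      ext x
      simp [cappedPolytope, and_assoc]
    rw [this]
    refine ((IsClosed.inter ?_ ?_).inter ?_).inter ?_
    · refine isClosed_biInter fun e _ => ?_
      exact (isClosed_le continuous_const (continuous_apply e)).inter
        (isClosed_le (continuous_apply e) continuous_const)
    · exact isClosed_biInter fun e _ => isClosed_eq (continuous_apply e) continuous_const
    · exact isClosed_iInter fun u => isClosed_le (by fun_prop) continuous_const
    · exact isClosed_iInter fun u => isClosed_le (by fun_prop) continuous_const
  · intro x hx e _
    by_cases he : e ∈ E
    · simpa [he] using hx.1 e he
    · simpa [he] using hx.2.1 e he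

theorem midpoint_mem_cappedPolytope {E : Finset ι} {l : ι → L} {r : ι → R} {c : ι → ℝ}
    {x y : ι → ℝ} (hx : x ∈ cappedPolytope E l r c) (hy : y ∈ cappedPolytope E l r c) :
    (fun e => (x e + y e) / 2) ∈ cappedPolytope E l r c := by
  refine ⟨fun e he => ?_, fun e he => ?_, fun u => ?_, fun v => ?_⟩
  · have := hx.1 e he
    have := hy.1 e he
    constructor <;> linarith
  · simp [hx.2.1 e he, hy.2.1 e he]
  · rw [← Finset.sum_div, Finset.sum_add_distrib]
    linarith [hx.2.2.1 u, hy.2.2.1 u]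
  · rw [← Finset.sum_div, Finset.sum_add_distrib]
    linarith [hx.2.2.2 v, hy.2.2.2 v]

/-- A maximum capacitated fractional matching whose set of unsaturated left vertices contains
that of every other maximum one. -/
theorem exists_maximum_with_maximal_slack (E : Finset ι) (l : ι → L) (r : ι → R) (c : ι → ℝ)
    (hc : ∀ e ∈ E, 0 ≤ c e) (U : Finset L) :
    ∃ x ∈ cappedPolytope E l r c,
      (∀ y ∈ cappedPolytope E l r c, ∑ e ∈ E, y e ≤ ∑ e ∈ E, x e) ∧
      ∀ y ∈ cappedPolytope E l r c, ∑ e ∈ E, y e = ∑ e ∈ E, x e →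
        ∀ u ∈ U, ∑ e ∈ E with l e = u, y e < 1 → ∑ e ∈ E with l e = u, x e < 1 := by
  classical
  have hne : (cappedPolytope E l r c).Nonempty :=
    ⟨fun _ => 0, fun e he => ⟨le_rfl, hc e he⟩, by simp, by simp, by simp⟩
  obtain ⟨x₀, hx₀, hmax⟩ := (isCompact_cappedPolytope E l r c).exists_isMaxOn hne
    (f := fun x => ∑ e ∈ E, x e) (by fun_prop)
  let slack : (ι → ℝ) → Finset L := fun x => {u ∈ U | ∑ e ∈ E with l e = u, x e < 1}
  let O := {x ∈ cappedPolytope E l r c | ∑ e ∈ E, x e = ∑ e ∈ E, x₀ e}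
  have hfin : (slack '' O).Finite :=
    (U.powerset.finite_toSet).subset (by rintro _ ⟨x, -, rfl⟩; exact Finset.mem_powerset.2 (Finset.filter_subset _ U))
  obtain ⟨_, ⟨x, hx, rfl⟩, hbig⟩ :=
    Set.exists_max_image (slack '' O) Finset.card hfin ⟨_, x₀, ⟨hx₀, rfl⟩, rfl⟩
  refine ⟨x, hx.1, fun y hy => hx.2 ▸ hmax hy, fun y hy hyx u hu hlt => ?_⟩
  by_contra hcon
  -- The midpoint of two maximum solutions is maximum, and it leaves unsaturated every vertex that
  -- either of them does; this would enlarge a slack set of maximum cardinality.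
  have hz : (fun e => (x e + y e) / 2) ∈ O := by
    refine ⟨midpoint_mem_cappedPolytope hx.1 hy, ?_⟩
    rw [← Finset.sum_div, Finset.sum_add_distrib, hyx, hx.2]
    ring
  have hsub : slack x ⊂ slack (fun e => (x e + y e) / 2) := by
    refine (Finset.ssubset_iff_of_subset fun w hw => ?_).2 ⟨u, ?_, ?_⟩
    · simp only [slack, Finset.mem_filter] at hw ⊢
      refine ⟨hw.1, ?_⟩
      rw [← Finset.sum_div, Finset.sum_add_distrib]
      linarith [hw.2, hy.2.2.1 w]
    · simp only [slack, Finset.mem_filter]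
      refine ⟨hu, ?_⟩
      rw [← Finset.sum_div, Finset.sum_add_distrib]
      linarith [hx.1.2.2.1 u]
    · simp only [slack, Finset.mem_filter, not_and]
      exact fun _ => hcon
  exact (Finset.card_lt_card hsub).not_ge (hbig _ ⟨_, hz, rfl⟩)

theorem sum_add_ite_eq [DecidableEq ι] (s : Finset ι) (x : ι → ℝ) (e : ι) (δ : ℝ) :
    ∑ f ∈ s, (x f + if f = e then δ else 0) = ∑ f ∈ s, x f + if e ∈ s then δ else 0 := by
  rw [Finset.sum_add_distrib, Finset.sum_ite_eq']

/-- A capacitated bipartite graph has a maximum fractional matching `x` and vertex sets `X`, `Y`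
such that `x` saturates the vertices outside `X` and `Y`, so that these number at most the value
of `x`, while the edges between `X` and `Y` carry their full capacity. -/
theorem exists_fractional_matching_cut (E : Finset ι) (l : ι → L) (r : ι → R) (c : ι → ℝ)
    (hc : ∀ e ∈ E, 0 ≤ c e) (U : Finset L) (V : Finset R)
    (hl : ∀ e ∈ E, l e ∈ U) :
    ∃ x ∈ cappedPolytope E l r c, ∃ X ⊆ U, ∃ Y ⊆ V,
      (((U \ X).card + (V \ Y).card : ℕ) : ℝ) ≤ ∑ e ∈ E, x e ∧
      (∀ u ∈ X, ∑ e ∈ E with l e = u ∧ r e ∈ Y, c e ≤ 1) ∧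
      ∀ v ∈ Y, ∑ e ∈ E with r e = v ∧ l e ∈ X, c e ≤ 1 := by
  classical
  obtain ⟨x, hx, hmax, hslack⟩ := exists_maximum_with_maximal_slack E l r c hc U
  -- Because the slack set of `x` is maximal, one step of the residual search from `X` replaces the
  -- usual alternating paths.
  set X : Finset L := {u ∈ U | ∑ e ∈ E with l e = u, x e < 1} with hX
  set Y : Finset R := {v ∈ V | ∀ e ∈ E, l e ∈ X → r e = v → x e = c e} with hY
  have htight : ∀ v ∈ V \ Y, ∃ e ∈ E, l e ∈ X ∧ r e = v ∧ x e < c e := by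
    intro v hv
    simp only [hY, Finset.mem_sdiff, Finset.mem_filter, not_and, not_forall] at hv
    obtain ⟨e, he, heX, hev, hne⟩ := hv.2 hv.1
    exact ⟨e, he, heX, hev, lt_of_le_of_ne (hx.1 e he).2 hne⟩
  have hXlt : ∀ u ∈ X, ∑ e ∈ E with l e = u, x e < 1 := fun u hu => (Finset.mem_filter.1 hu).2
  -- Otherwise a non-full edge from `X` to `v` could be raised by `δ`, increasing the value.
  have hB : ∀ v ∈ V \ Y, ∑ e ∈ E with r e = v, x e = 1 := by
    intro v hv
    obtain ⟨e, he, heX, rfl, hlt⟩ := htight v hv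
    by_contra hne
    have h1 : ∑ f ∈ E with r f = r e, x f < 1 := lt_of_le_of_ne (hx.2.2.2 _) hne
    obtain ⟨δ, hδ, hδ'⟩ := exists_between
      (lt_min (sub_pos.2 hlt) (lt_min (sub_pos.2 h1) (sub_pos.2 (hXlt _ heX))))
    simp only [lt_min_iff] at hδ'
    have := hmax (fun f => x f + if f = e then δ else 0) ?_
    · rw [sum_add_ite_eq, if_pos he] at this
      linarith
    · refine ⟨fun f hf => ?_, fun f hf => ?_, fun u => ?_, fun v => ?_⟩
      · have := hx.1 f hf
        dsimp only
        split_ifs with h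
        · subst h; constructor <;> linarith
        · simpa using this
      · have : f ≠ e := fun h => hf (h ▸ he)
        simp [this, hx.2.1 f hf]
      · rw [sum_add_ite_eq]
        split_ifs with h
        · obtain ⟨-, rfl⟩ := Finset.mem_filter.1 h; linarith
        · simpa using hx.2.2.1 u
      · rw [sum_add_ite_eq]
        split_ifs with h
        · obtain ⟨-, rfl⟩ := Finset.mem_filter.1 h; linarith
        · simpa using hx.2.2.2 v
  -- Otherwise move `δ` from `e'` to a non-full edge from `X` with the same right end. The value is
  -- unchanged and `l e'` becomes unsaturated, so maximality of the slack set puts it in `X`.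
  have hzero : ∀ e' ∈ E, l e' ∉ X → r e' ∈ V \ Y → x e' = 0 := by
    intro e' he' hX' hY'
    obtain ⟨e, he, heX, hr, hlt⟩ := htight _ hY'
    by_contra hne
    have hpos : 0 < x e' := lt_of_le_of_ne (hx.1 e' he').1 (Ne.symm hne)
    obtain ⟨δ, hδ, hδ'⟩ := exists_between
      (lt_min (sub_pos.2 hlt) (lt_min hpos (sub_pos.2 (hXlt _ heX))))
    simp only [lt_min_iff] at hδ'
    have hll : l e ≠ l e' := fun h => hX' (h ▸ heX)
    have hee : e ≠ e' := fun h => hll (h ▸ rfl)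
    refine hX' (Finset.mem_filter.2 ⟨hl e' he', ?_⟩)
    refine hslack (fun f => (x f + if f = e then δ else 0) + if f = e' then -δ else 0) ?_ ?_ _
      (hl e' he') ?_
    · refine ⟨fun f hf => ?_, fun f hf => ?_, fun u => ?_, fun v => ?_⟩
      · have := hx.1 f hf
        dsimp only
        split_ifs with h h' h'
        · exact absurd (h ▸ h') hee
        · subst h; constructor <;> linarith
        · subst h'; constructor <;> linarith
        · simpa using this
      · have h1 : f ≠ e := fun h => hf (h ▸ he)
        have h2 : f ≠ e' := fun h => hf (h ▸ he')
        simp [h1, h2, hx.2.1 f hf]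
      · rw [sum_add_ite_eq, sum_add_ite_eq]
        have := hx.2.2.1 u
        split_ifs with h h' h'
        · linarith
        · obtain ⟨-, rfl⟩ := Finset.mem_filter.1 h; linarith
        · linarith
        · linarith
      · rw [sum_add_ite_eq, sum_add_ite_eq]
        have := hx.2.2.2 v
        have hiff : e ∈ ({f ∈ E | r f = v} : Finset ι) ↔ e' ∈ ({f ∈ E | r f = v} : Finset ι) := by
          simp [he, he', hr]
        split_ifs with h h' h'
        · linarith
        · exact absurd (hiff.1 h) h'
        · linarith
        · linarith
    · rw [sum_add_ite_eq, sum_add_ite_eq, if_pos he, if_pos he']; ring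
    · rw [sum_add_ite_eq, sum_add_ite_eq, if_neg (by simp [hll]), if_pos (by simp [he'])]
      linarith [hx.2.2.1 (l e')]
  refine ⟨x, hx, X, Finset.filter_subset _ _, Y, Finset.filter_subset _ _, ?_, ?_, ?_⟩
  · have hA : ∀ u ∈ U \ X, ∑ e ∈ E with l e = u, x e = 1 := by
      intro u hu
      rw [hX, Finset.mem_sdiff, Finset.mem_filter, not_and] at hu
      exact le_antisymm (hx.2.2.1 u) (not_lt.1 (hu.2 hu.1))
    have e1 : ((U \ X).card : ℝ) = ∑ e ∈ E with l e ∈ U \ X, x e := by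
      rw [← Finset.sum_fiberwise_of_maps_to (g := l) (t := U \ X)
        (fun e he => (Finset.mem_filter.1 he).2)]
      rw [Finset.card_eq_sum_ones, Nat.cast_sum]
      refine Finset.sum_congr rfl fun u hu => ?_
      rw [Finset.filter_filter, Nat.cast_one, ← hA u hu]
      refine Finset.sum_congr (Finset.filter_congr fun e _ => ?_) fun _ _ => rfl
      exact ⟨fun h => ⟨h ▸ hu, h⟩, fun h => h.2⟩
    have e2 : ((V \ Y).card : ℝ) = ∑ e ∈ E with r e ∈ V \ Y, x e := by
      rw [← Finset.sum_fiberwise_of_maps_to (g := r) (t := V \ Y)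
        (fun e he => (Finset.mem_filter.1 he).2)]
      rw [Finset.card_eq_sum_ones, Nat.cast_sum]
      refine Finset.sum_congr rfl fun u hu => ?_
      rw [Finset.filter_filter, Nat.cast_one, ← hB u hu]
      refine Finset.sum_congr (Finset.filter_congr fun e _ => ?_) fun _ _ => rfl
      exact ⟨fun h => ⟨h ▸ hu, h⟩, fun h => h.2⟩
    -- Only edges with both ends outside `X` and `Y` would be counted twice, and these carry zero by
    -- `hzero`.
    rw [Nat.cast_add, e1, e2, Finset.sum_filter, Finset.sum_filter, ← Finset.sum_add_distrib]
    refine Finset.sum_le_sum fun e he => ?_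
    have h0 := (hx.1 e he).1
    split_ifs with h h'
    · rw [hzero e he (Finset.mem_sdiff.1 h).2 h']; simp
    all_goals simp [h0]
  · intro u hu
    calc ∑ e ∈ E with l e = u ∧ r e ∈ Y, c e = ∑ e ∈ E with l e = u ∧ r e ∈ Y, x e := by
          refine Finset.sum_congr rfl fun e he => ?_
          obtain ⟨heE, rfl, hr⟩ := Finset.mem_filter.1 he
          exact ((Finset.mem_filter.1 hr).2 e heE hu rfl).symm
      _ ≤ ∑ e ∈ E with l e = u, x e := by
          refine Finset.sum_le_sum_of_subset_of_nonneg (fun e he => ?_) fun e he _ =>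
            (hx.1 e (Finset.mem_filter.1 he).1).1
          simp only [Finset.mem_filter] at he ⊢
          exact ⟨he.1, he.2.1⟩
      _ ≤ 1 := hx.2.2.1 u
  · intro v hv
    calc ∑ e ∈ E with r e = v ∧ l e ∈ X, c e = ∑ e ∈ E with r e = v ∧ l e ∈ X, x e := by
          refine Finset.sum_congr rfl fun e he => ?_
          obtain ⟨heE, rfl, hr⟩ := Finset.mem_filter.1 he
          exact ((Finset.mem_filter.1 hv).2 e heE hr rfl).symm
      _ ≤ ∑ e ∈ E with r e = v, x e := by
          refine Finset.sum_le_sum_of_subset_of_nonneg (fun e he => ?_) fun e he _ =>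
            (hx.1 e (Finset.mem_filter.1 he).1).1
          simp only [Finset.mem_filter] at he ⊢
          exact ⟨he.1, he.2.1⟩
      _ ≤ 1 := hx.2.2.2 v

end Cut

/-! ### Chernoff bound and numerical estimate -/

theorem mgf_indicator_one_le {Ω : Type*} [MeasurableSpace Ω] {P : Measure Ω}
    [IsProbabilityMeasure P] {A : Set Ω} (hA : MeasurableSet A) (t : ℝ) :
    mgf (A.indicator fun _ => (1 : ℝ)) P t ≤ Real.exp ((Real.exp t - 1) * P.real A) := by
  have h : (fun ω => Real.exp (t * A.indicator (fun _ => (1 : ℝ)) ω)) =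
      fun ω => 1 + A.indicator (fun _ => Real.exp t - 1) ω := by
    ext ω
    by_cases hω : ω ∈ A <;> simp [hω]
  rw [mgf, h, integral_add (integrable_const _) ((integrable_const _).indicator hA),
    integral_indicator_const _ hA]
  simp only [integral_const, probReal_univ, smul_eq_mul, mul_one]
  linarith [Real.add_one_le_exp ((Real.exp t - 1) * P.real A)]

open Classical in
/-- Chernoff bound for the number of independent events that occur. -/
theorem measure_le_card_le_exp {ι Ω : Type*} [MeasurableSpace Ω] {P : Measure Ω}
    [IsProbabilityMeasure P] {A : ι → Set Ω} (hA : ∀ i, MeasurableSet (A i))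
    (hind : iIndepSet A P) (F : Finset ι) {t : ℝ} (ht : 0 ≤ t) (b : ℝ) :
    P.real {ω | b ≤ (({i ∈ F | ω ∈ A i} : Finset ι).card : ℝ)} ≤
      Real.exp (-t * b + (Real.exp t - 1) * ∑ i ∈ F, P.real (A i)) := by
  set X : ι → Ω → ℝ := fun i => (A i).indicator fun _ => (1 : ℝ)
  have hXm : ∀ i, Measurable (X i) := fun i => measurable_const.indicator (hA i)
  have hcard : ∀ ω, (({i ∈ F | ω ∈ A i} : Finset ι).card : ℝ) = (∑ i ∈ F, X i) ω := by
    intro ω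
    simp [X, Finset.sum_apply, Set.indicator_apply]
  have hint : Integrable (fun ω => Real.exp (t * (∑ i ∈ F, X i) ω)) P := by
    have hm : Measurable fun ω => Real.exp (t * (∑ i ∈ F, X i) ω) := by fun_prop
    refine Integrable.of_bound hm.aestronglyMeasurable (Real.exp (t * F.card))
      (Filter.Eventually.of_forall fun ω => ?_)
    rw [Real.norm_eq_abs, Real.abs_exp, ← hcard]
    gcongr
    exact Finset.filter_subset _ _
  simp_rw [hcard]
  refine (measure_ge_le_exp_mul_mgf b ht hint).trans ?_
  rw [Real.exp_add]
  refine mul_le_mul_of_nonneg_left ?_ (Real.exp_pos _).le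
  rw [hind.iIndepFun_indicator.mgf_sum hXm, Finset.mul_sum, Real.exp_sum]
  exact Finset.prod_le_prod (fun _ _ => mgf_nonneg) fun i _ => mgf_indicator_one_le (hA i) t

/-- The numerical estimate behind the union bound. -/
theorem union_bound_exponent {ε : ℝ} (hε : 0 < ε) (hε' : ε < 1 / 2) :
    Real.exp (16 / ε) * (2 : ℝ) ^ (-(20 / ε ^ 2)) * (16 / ε) ≤ 1 := by
  set y := 1 / ε with hy
  have hy2 : 2 < y := by rw [hy, lt_div_iff₀ hε]; linarith
  have h16 : 16 / ε = 16 * y := by rw [hy]; ring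
  have h20 : 20 / ε ^ 2 = 20 * y ^ 2 := by rw [hy]; field_simp
  have hlog := Real.log_two_gt_d9
  rw [h16, h20, Real.rpow_def_of_pos two_pos, ← Real.exp_add]
  have hb : 16 * y ≤ Real.exp (5 * y ^ 2) := by
    have h1 : 2 * y ^ 2 ≤ Real.exp (2 * y ^ 2) := by linarith [Real.add_one_le_exp (2 * y ^ 2)]
    have h2 : 3 * y ^ 2 ≤ Real.exp (3 * y ^ 2) := by linarith [Real.add_one_le_exp (3 * y ^ 2)]
    have h3 : Real.exp (5 * y ^ 2) = Real.exp (2 * y ^ 2) * Real.exp (3 * y ^ 2) := by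
      rw [← Real.exp_add]; congr 1; ring
    rw [h3]
    refine le_trans ?_ (mul_le_mul h1 h2 (by positivity) (Real.exp_pos _).le)
    have h4 : 4 ≤ y ^ 2 := by nlinarith
    nlinarith
  -- Since `y > 2`, 16y + 5y² < 13y², while 20 log 2 > 13.
  refine (mul_le_mul_of_nonneg_left hb (Real.exp_pos _).le).trans ?_
  rw [← Real.exp_add, Real.exp_le_one_iff]
  nlinarith

/-! ### Matchings, vertex covers and double covers of multigraphs -/

variable {α β : Type*}

theorem bddAbove_matching_sizes (G : Graph α β) (hE : G.edgeSet.Finite) :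
    BddAbove {k : ℕ | ∃ M : Set β, IsMatching G M ∧ M.ncard = k} := by
  refine ⟨G.edgeSet.ncard, ?_⟩
  rintro _ ⟨M, hM, rfl⟩
  exact Set.ncard_le_ncard hM.1 hE

theorem IsMatching.ncard_le {G : Graph α β} (hE : G.edgeSet.Finite) {M : Set β}
    (hM : IsMatching G M) : M.ncard ≤ matchingNumber G :=
  le_csSup (bddAbove_matching_sizes G hE) ⟨M, hM, rfl⟩

theorem exists_isMatching_ncard_eq (G : Graph α β) (hE : G.edgeSet.Finite) :
    ∃ M : Set β, IsMatching G M ∧ M.ncard = matchingNumber G :=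
  Nat.sSup_mem (s := {k : ℕ | ∃ M : Set β, IsMatching G M ∧ M.ncard = k})
    ⟨_, ∅, ⟨Set.empty_subset _, by simp⟩, rfl⟩ (bddAbove_matching_sizes G hE)

/-- The endpoints of a maximum matching form a vertex cover. -/
theorem exists_vertex_cover (G : Graph α β) (hE : G.edgeSet.Finite) :
    ∃ T : Finset α, T.card ≤ 2 * matchingNumber G ∧
      ∀ e u v, G.IsLink e u v → u ∈ T ∨ v ∈ T := by
  classical
  obtain ⟨M, hM, hcard⟩ := exists_isMatching_ncard_eq G hE
  have hMfin : M.Finite := hE.subset hM.1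
  have hends : ∀ e : β, ∃ s : Finset α, s.card ≤ 2 ∧ ∀ v, G.Inc e v → v ∈ s := by
    intro e
    by_cases he : e ∈ G.edgeSet
    · obtain ⟨x, y, h⟩ := Graph.exists_isLink_of_mem_edgeSet he
      exact ⟨{x, y}, Finset.card_le_two, fun v hv => by simpa using hv.eq_or_eq_of_isLink h⟩
    · exact ⟨∅, by simp, fun v hv => absurd hv.edge_mem he⟩
  choose s hs2 hs using hends
  refine ⟨hMfin.toFinset.biUnion s, ?_, fun e u v huv => ?_⟩
  · rw [← hcard, Set.ncard_eq_toFinset_card M hMfin, mul_comm]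
    exact Finset.card_biUnion_le_card_mul _ _ _ fun e _ => hs2 e
  · by_contra! hcon
    simp only [Finset.mem_biUnion, Set.Finite.mem_toFinset, not_exists, not_and] at hcon
    have hdisj : ∀ f ∈ M, ∀ w, G.Inc e w → ¬ G.Inc f w := by
      intro f hf w hew hfw
      rcases hew.eq_or_eq_of_isLink huv with rfl | rfl
      · exact hcon.1 f hf (hs f _ hfw)
      · exact hcon.2 f hf (hs f _ hfw)
    have heM : e ∉ M := fun he => hdisj e he u huv.inc_left huv.inc_left
    have hM' : IsMatching G (insert e M) := by
      refine ⟨Set.insert_subset huv.edge_mem hM.1, ?_⟩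
      rintro f (rfl | hf) g (rfl | hg) w hfw hgw
      · rfl
      · exact absurd hgw (hdisj g hg w hfw)
      · exact absurd hfw (hdisj f hf w hgw)
      · exact hM.2 f hf g hg w hfw hgw
    have := hM'.ncard_le hE
    rw [Set.ncard_insert_of_notMem heM hMfin] at this
    omega

theorem doubleCover_inc_inl {H : Graph α β} {d : β × α} {a : α} :
    (doubleCover H).Inc d (Sum.inl a) ↔ d.2 = a ∧ ∃ v, H.IsLink d.1 d.2 v := by
  constructor
  · rintro ⟨q, v, hv, ⟨h, -⟩ | ⟨h, -⟩⟩
    · exact ⟨(Sum.inl.inj h).symm, v, hv⟩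
    · simp at h
  · rintro ⟨rfl, v, hv⟩
    exact ⟨_, v, hv, Or.inl ⟨rfl, rfl⟩⟩

theorem doubleCover_inc_inr {H : Graph α β} {d : β × α} {b : α} :
    (doubleCover H).Inc d (Sum.inr b) ↔ H.IsLink d.1 d.2 b := by
  constructor
  · rintro ⟨q, v, hv, ⟨h, -⟩ | ⟨h, -⟩⟩
    · simp at h
    · exact Sum.inr.inj h ▸ hv
  · intro hv
    exact ⟨_, b, hv, Or.inr ⟨rfl, rfl⟩⟩

theorem mem_edgeSet_doubleCover {H : Graph α β} {d : β × α} :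
    d ∈ (doubleCover H).edgeSet ↔ ∃ v, H.IsLink d.1 d.2 v := by
  constructor
  · intro hd
    obtain ⟨x, y, v, hv, -⟩ := Graph.exists_isLink_of_mem_edgeSet hd
    exact ⟨v, hv⟩
  · rintro ⟨v, hv⟩
    exact (doubleCover_inc_inr.2 hv).edge_mem

theorem finite_edgeSet_doubleCover {H : Graph α β} (hV : H.vertexSet.Finite)
    (hE : H.edgeSet.Finite) : (doubleCover H).edgeSet.Finite := by
  refine (hE.prod hV).subset fun d hd => ?_
  obtain ⟨v, hv⟩ := mem_edgeSet_doubleCover.1 hd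
  exact ⟨hv.edge_mem, hv.left_mem⟩

/-- The real `sSup` of an unbounded set is 0, so a feasible vector bounds the value from below only
once this is known. -/
theorem bddAbove_fractional_values {H : Graph α β} (hE : H.edgeSet.Finite) (c : β → ℝ) :
    BddAbove {r : ℝ | ∃ x : β → ℝ, IsFractionalMatching H x ∧ (∀ e ∈ H.edgeSet, x e ≤ c e) ∧
      ∑ᶠ e ∈ H.edgeSet, x e = r} := by
  refine ⟨∑ e ∈ hE.toFinset, c e, ?_⟩
  rintro _ ⟨x, -, hxc, rfl⟩
  rw [finsum_mem_eq_finite_toFinset_sum _ hE]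
  exact Finset.sum_le_sum fun e he => hxc e (hE.mem_toFinset.1 he)

/-- There are vertex sets `X`, `Y` of `H` whose complements number at most the fractional matching
value of the double cover, and such that every vertex of either set sends capacity at most one to
the other set. -/
theorem exists_cut_doubleCover {H : Graph α β} (hV : H.vertexSet.Finite)
    (hE : H.edgeSet.Finite) (c : β → ℝ) (hc : ∀ e ∈ H.edgeSet, 0 ≤ c e) [DecidableEq α] :
    ∃ X ⊆ hV.toFinset, ∃ Y ⊆ hV.toFinset,
      (((hV.toFinset \ X).card + (hV.toFinset \ Y).card : ℕ) : ℝ) ≤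
        fractionalMatchingValue (doubleCover H) (doubleCoverCapacity c) ∧
      (∀ u ∈ X, ∀ F : Finset β, (∀ f ∈ F, ∃ v ∈ Y, H.IsLink f u v) → ∑ f ∈ F, c f ≤ 1) ∧
      ∀ v ∈ Y, ∀ F : Finset β, (∀ f ∈ F, ∃ u ∈ X, H.IsLink f u v) → ∑ f ∈ F, c f ≤ 1 := by
  classical
  have hD := finite_edgeSet_doubleCover hV hE
  -- The right end of a copy `d`; off the edge set the value is arbitrary.
  have hother : ∀ d : β × α, ∃ w, ∀ v, H.IsLink d.1 d.2 v → w = v := by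
    intro d
    by_cases h : ∃ v, H.IsLink d.1 d.2 v
    · exact ⟨h.choose, fun v hv => h.choose_spec.right_unique hv⟩
    · exact ⟨d.2, fun v hv => absurd ⟨v, hv⟩ h⟩
  choose r hr using hother
  have hlink : ∀ d ∈ hD.toFinset, H.IsLink d.1 d.2 (r d) := by
    intro d hd
    obtain ⟨v, hv⟩ := mem_edgeSet_doubleCover.1 (hD.mem_toFinset.1 hd)
    rwa [hr d v hv]
  have hmem : ∀ {f u v}, H.IsLink f u v → (f, u) ∈ hD.toFinset := fun h =>
    hD.mem_toFinset.2 (mem_edgeSet_doubleCover.2 ⟨_, h⟩)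
  have hc' : ∀ d ∈ hD.toFinset, 0 ≤ doubleCoverCapacity (α := α) c d := fun d hd =>
    hc _ (hlink d hd).edge_mem
  obtain ⟨x, hx, X, hX, Y, hY, hval, hcX, hcY⟩ := exists_fractional_matching_cut hD.toFinset
    Prod.snd r (doubleCoverCapacity c) hc' hV.toFinset hV.toFinset
    fun d hd => hV.mem_toFinset.2 (hlink d hd).left_mem
  refine ⟨X, hX, Y, hY, ?_, fun u hu F hF => ?_, fun v hv F hF => ?_⟩
  · refine hval.trans (le_csSup (bddAbove_fractional_values hD _) ⟨x, ⟨?_, ?_⟩, ?_, ?_⟩)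
    · exact fun d hd => (hx.1 d (hD.mem_toFinset.2 hd)).1
    · rintro (a | b) -
      · have : {d | (doubleCover H).Inc d (Sum.inl a)} =
            ↑({d ∈ hD.toFinset | d.2 = a} : Finset (β × α)) := by
          ext d
          simp [doubleCover_inc_inl, mem_edgeSet_doubleCover, and_comm]
        rw [this, finsum_mem_coe_finset]
        exact hx.2.2.1 a
      · have : {d | (doubleCover H).Inc d (Sum.inr b)} =
            ↑({d ∈ hD.toFinset | r d = b} : Finset (β × α)) := by
          ext d
          simp only [Set.mem_ofPred_eq, doubleCover_inc_inr, Finset.coe_filter]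
          exact ⟨fun h => ⟨hmem h, hr d b h⟩, fun h => h.2 ▸ hlink d h.1⟩
        rw [this, finsum_mem_coe_finset]
        exact hx.2.2.2 b
    · exact fun d hd => (hx.1 d (hD.mem_toFinset.2 hd)).2
    · rw [finsum_mem_eq_finite_toFinset_sum _ hD]
  · have himg : ∑ f ∈ F, c f = ∑ d ∈ F.image fun f => (f, u), doubleCoverCapacity c d := by
      rw [Finset.sum_image fun f _ g _ h => congrArg Prod.fst h]; rfl
    rw [himg]
    refine le_trans (Finset.sum_le_sum_of_subset_of_nonneg (fun d hd => ?_)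
      fun d hd _ => hc' d (Finset.mem_filter.1 hd).1) (hcX u hu)
    obtain ⟨f, hf, rfl⟩ := Finset.mem_image.1 hd
    obtain ⟨v, hv, hfv⟩ := hF f hf
    exact Finset.mem_filter.2 ⟨hmem hfv, rfl, hr (f, u) v hfv ▸ hv⟩
  · have : Nonempty α := ⟨v⟩
    choose! u hu hfu using hF
    have himg : ∑ f ∈ F, c f = ∑ d ∈ F.image fun f => (f, u f), doubleCoverCapacity c d := by
      rw [Finset.sum_image fun f _ g _ h => congrArg Prod.fst h]; rfl
    rw [himg]
    refine le_trans (Finset.sum_le_sum_of_subset_of_nonneg (fun d hd => ?_)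
      fun d hd _ => hc' d (Finset.mem_filter.1 hd).1) (hcY v hv)
    obtain ⟨f, hf, rfl⟩ := Finset.mem_image.1 hd
    exact Finset.mem_filter.2 ⟨hmem (hfu f hf), hr (f, u f) v (hfu f hf), hu f hf⟩

/-- Weak duality: each matching edge either uses up a left vertex outside `X` or a right vertex
outside `Y`, or is one of the two copies of an edge of `K`. -/
theorem matchingNumber_doubleCover_le {H : Graph α β} (hV : H.vertexSet.Finite)
    (hE : H.edgeSet.Finite) [DecidableEq α] (X Y : Finset α) (K : Finset β)
    (hK : ∀ e u v, H.IsLink e u v → u ∈ X → v ∈ Y → e ∈ K) :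
    matchingNumber (doubleCover H) ≤
      (hV.toFinset \ X).card + (hV.toFinset \ Y).card + 2 * K.card := by
  classical
  have hD := finite_edgeSet_doubleCover hV hE
  obtain ⟨M, hM, hcard⟩ := exists_isMatching_ncard_eq (doubleCover H) hD
  have hMfin : M.Finite := hD.subset hM.1
  rw [← hcard, Set.ncard_eq_toFinset_card M hMfin]
  have hlink : ∀ d ∈ M, ∃ v, H.IsLink d.1 d.2 v := fun d hd =>
    mem_edgeSet_doubleCover.1 (hM.1 hd)
  have hother : ∀ d : β × α, ∃ v, d ∈ M → H.IsLink d.1 d.2 v := fun d => by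
    by_cases hd : d ∈ M
    · exact (hlink d hd).imp fun v hv _ => hv
    · exact ⟨d.2, fun h => absurd h hd⟩
  choose r hr using hother
  set N := hMfin.toFinset with hN
  have hNM : ∀ {d}, d ∈ N → d ∈ M := fun h => hMfin.mem_toFinset.1 h
  have h1 : ({d ∈ N | d.2 ∉ X} : Finset _).card ≤ (hV.toFinset \ X).card := by
    refine Finset.card_le_card_of_injOn Prod.snd (fun d hd => ?_) fun d hd d' hd' h => ?_
    · obtain ⟨hd, hdX⟩ := Finset.mem_filter.1 hd
      exact Finset.mem_sdiff.2 ⟨hV.mem_toFinset.2 (hr d (hNM hd)).left_mem, hdX⟩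
    · have hd := hNM (Finset.mem_filter.1 hd).1
      have hd' := hNM (Finset.mem_filter.1 hd').1
      exact hM.2 d hd d' hd' (Sum.inl d.2) (doubleCover_inc_inl.2 ⟨rfl, _, hr d hd⟩)
        (doubleCover_inc_inl.2 ⟨h.symm, _, hr d' hd'⟩)
  have h2 : ({d ∈ N | r d ∉ Y} : Finset _).card ≤ (hV.toFinset \ Y).card := by
    refine Finset.card_le_card_of_injOn r (fun d hd => ?_) fun d hd d' hd' h => ?_
    · obtain ⟨hd, hdX⟩ := Finset.mem_filter.1 hd
      exact Finset.mem_sdiff.2 ⟨hV.mem_toFinset.2 (hr d (hNM hd)).right_mem, hdX⟩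
    · have hd := hNM (Finset.mem_filter.1 hd).1
      have hd' := hNM (Finset.mem_filter.1 hd').1
      exact hM.2 d hd d' hd' (Sum.inr (r d)) (doubleCover_inc_inr.2 (hr d hd))
        (doubleCover_inc_inr.2 (h ▸ hr d' hd'))
  have h3 : ({d ∈ N | d.2 ∈ X ∧ r d ∈ Y} : Finset _).card ≤ 2 * K.card := by
    refine Finset.card_le_mul_card_image_of_maps_to (f := Prod.fst) (fun d hd => ?_) 2
      fun e he => ?_
    · obtain ⟨hd, hdX, hdY⟩ := Finset.mem_filter.1 hd
      exact hK _ _ _ (hr d (hNM hd)) hdX hdY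
    · by_cases hedge : e ∈ H.edgeSet
      · obtain ⟨x, y, hxy⟩ := Graph.exists_isLink_of_mem_edgeSet hedge
        refine (Finset.card_le_card (t := {(e, x), (e, y)}) fun d hd => ?_).trans
          Finset.card_le_two
        obtain ⟨hd, rfl⟩ := Finset.mem_filter.1 hd
        have hd := hNM (Finset.mem_filter.1 (Finset.mem_filter.1 hd).1).1
        rcases (hr d hd).left_eq_or_eq hxy with h | h
        · exact Finset.mem_insert.2 (Or.inl (Prod.ext rfl h))
        · exact Finset.mem_insert.2 (Or.inr (Finset.mem_singleton.2 (Prod.ext rfl h)))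
      · rw [Finset.card_eq_zero.2]
        · omega
        · refine Finset.eq_empty_of_forall_notMem fun d hd => hedge ?_
          obtain ⟨hd, rfl⟩ := Finset.mem_filter.1 hd
          exact (hr d (hNM (Finset.mem_filter.1 (Finset.mem_filter.1 hd).1).1)).edge_mem
  have hcover : N ⊆ ({d ∈ N | d.2 ∉ X} ∪ {d ∈ N | r d ∉ Y}) ∪ {d ∈ N | d.2 ∈ X ∧ r d ∈ Y} := by
    intro d hd
    simp only [Finset.mem_union, Finset.mem_filter, hd, true_and]
    tauto
  have := Finset.card_le_card hcover
  have := Finset.card_union_le ({d ∈ N | d.2 ∉ X} ∪ {d ∈ N | r d ∉ Y})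
    {d ∈ N | d.2 ∈ X ∧ r d ∈ Y}
  have := Finset.card_union_le {d ∈ N | d.2 ∉ X} {d ∈ N | r d ∉ Y}
  omega

/-! ### Sampling and light boundaries -/

open Classical in
/-- Chernoff bound for the number of sampled edges of `F`. -/
theorem IsIndepEdgeSample.measure_le_card_le {Ω : Type*} [MeasurableSpace Ω] {G : Graph α β}
    {p : β → ℝ} {P : Measure Ω} [IsProbabilityMeasure P] {S : Ω → Set β}
    (hS : IsIndepEdgeSample G p P S) (F : Finset β) (hF : ∀ e ∈ F, e ∈ G.edgeSet)
    {t : ℝ} (ht : 0 ≤ t) (b : ℝ) :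
    P.real {ω | b ≤ (({e ∈ F | e ∈ S ω} : Finset β).card : ℝ)} ≤
      Real.exp (-t * b + (Real.exp t - 1) * ∑ e ∈ F, p e) := by
  have h := measure_le_card_le_exp (fun e : G.edgeSet => hS.measurableSet_mem e e.2) hS.indep
    (F.subtype (· ∈ G.edgeSet)) ht b
  have hsum : ∑ e ∈ F.subtype (· ∈ G.edgeSet), P.real {ω | (e : β) ∈ S ω} = ∑ e ∈ F, p e := by
    rw [Finset.sum_subtype_of_mem (fun e => P.real {ω | e ∈ S ω}) hF]
    exact Finset.sum_congr rfl fun e he => hS.prob_mem e (hF e he)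
  have hcard : ∀ ω, ({e ∈ F.subtype (· ∈ G.edgeSet) | (e : β) ∈ S ω} : Finset G.edgeSet).card =
      ({e ∈ F | e ∈ S ω} : Finset β).card := by
    intro ω
    rw [Finset.card_filter, Finset.card_filter]
    exact Finset.sum_subtype_of_mem (fun e => if e ∈ S ω then 1 else 0) hF
  rw [hsum] at h
  simpa only [Set.mem_ofPred_eq, hcard] using h

open Classical in
/-- The edges of `F` that join a vertex of `Q` to a vertex sending capacity at most one to `Q`
along `F`. -/
noncomputable def lightBoundary (G : Graph α β) (F : Finset β) (c : β → ℝ) (Q : Finset α) :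
    Finset β :=
  {e ∈ F | ∃ u v, G.IsLink e u v ∧ v ∈ Q ∧ ∑ f ∈ F with ∃ w ∈ Q, G.IsLink f u w, c f ≤ 1}

/-- Charge each edge to an end that sends capacity at most 1 to `Q`; every vertex is then charged at
most 1. -/
theorem sum_lightBoundary_le {G : Graph α β} (hV : G.vertexSet.Finite) (F : Finset β)
    (c : β → ℝ) (hc : ∀ e ∈ F, 0 ≤ c e) (Q : Finset α) :
    ∑ e ∈ lightBoundary G F c Q, c e ≤ G.vertexSet.ncard := by
  classical
  have h : ∀ e ∈ lightBoundary G F c Q, ∃ u, (∃ v, G.IsLink e u v ∧ v ∈ Q) ∧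
      ∑ f ∈ F with ∃ w ∈ Q, G.IsLink f u w, c f ≤ 1 := by
    intro e he
    obtain ⟨-, u, v, huv, hv, hle⟩ := Finset.mem_filter.1 he
    exact ⟨u, ⟨v, huv, hv⟩, by convert hle⟩
  rcases (lightBoundary G F c Q).eq_empty_or_nonempty with h0 | ⟨e₀, he₀⟩
  · simp [h0]
  have : Nonempty α := ⟨(h e₀ he₀).choose⟩
  choose! g hg hle using h
  rw [← Finset.sum_fiberwise_of_maps_to (g := g) (t := hV.toFinset) fun e he =>
    hV.mem_toFinset.2 (hg e he).choose_spec.1.left_mem, Set.ncard_eq_toFinset_card _ hV,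
    Finset.card_eq_sum_ones, Nat.cast_sum]
  refine Finset.sum_le_sum fun u hu => ?_
  rw [Nat.cast_one]
  rcases Finset.eq_empty_or_nonempty {e ∈ lightBoundary G F c Q | g e = u} with h0 | ⟨e, he⟩
  · simp [h0]
  obtain ⟨heB, rfl⟩ := Finset.mem_filter.1 he
  refine le_trans (Finset.sum_le_sum_of_subset_of_nonneg (fun f hf => ?_) fun f hf _ =>
    hc f (Finset.mem_filter.1 hf).1) (hle e heB)
  obtain ⟨hf, hfe⟩ := Finset.mem_filter.1 hf
  obtain ⟨v, hv, hvQ⟩ := hg f hf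
  exact Finset.mem_filter.2 ⟨(Finset.mem_filter.1 hf).1, v, hvQ, hfe ▸ hv⟩

open Classical in
/-- If few edges of each light boundary are sampled, then the double covers of the sampled
induced subgraphs have no large matchings. -/
theorem matchingNumber_sample_le {G : Graph α β} (hV : G.vertexSet.Finite)
    (F : Finset β) (c : β → ℝ) (hc : ∀ e ∈ F, 0 ≤ c e) (T : Finset α)
    (hT : ∀ e u v, G.IsLink e u v → u ∈ T ∨ v ∈ T) (S : Set β) (b : ℝ)
    (hb : ∀ Q ⊆ T, (({e ∈ lightBoundary G F c Q | e ∈ S} : Finset β).card : ℝ) ≤ b)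
    {W : Set α} (hW : W ⊆ G.vertexSet) :
    (matchingNumber (doubleCover (((G.restrict S).induce W).restrict F)) : ℝ) ≤
      fractionalMatchingValue (doubleCover ((G.induce W).restrict F)) (doubleCoverCapacity c) +
        4 * b := by
  have hWfin : W.Finite := hV.subset hW
  have hE1 : ((G.induce W).restrict F).edgeSet.Finite :=
    F.finite_toSet.subset fun e he => he.2
  have hE2 : (((G.restrict S).induce W).restrict F).edgeSet.Finite :=
    F.finite_toSet.subset fun e he => he.2
  have hV1 : ((G.induce W).restrict F).vertexSet.Finite := hWfin
  have hV2 : (((G.restrict S).induce W).restrict F).vertexSet.Finite := hWfin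
  obtain ⟨X, hX, Y, hY, hval, hcX, hcY⟩ := exists_cut_doubleCover hV1 hE1 c fun e he => hc e he.2
  have hXW : ∀ u ∈ X, u ∈ W := fun u hu => hV1.mem_toFinset.1 (hX hu)
  have hYW : ∀ u ∈ Y, u ∈ W := fun u hu => hV1.mem_toFinset.1 (hY hu)
  have hmatch := matchingNumber_doubleCover_le hV2 hE2 X Y
    ({e ∈ lightBoundary G F c (T ∩ X) | e ∈ S} ∪ {e ∈ lightBoundary G F c (T ∩ Y) | e ∈ S}) ?_
  · have hu := Finset.card_union_le {e ∈ lightBoundary G F c (T ∩ X) | e ∈ S}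
      {e ∈ lightBoundary G F c (T ∩ Y) | e ∈ S}
    have h1 := hb _ (Finset.inter_subset_left (s₁ := T) (s₂ := X))
    have h2 := hb _ (Finset.inter_subset_left (s₁ := T) (s₂ := Y))
    have hmatch' : (matchingNumber (doubleCover (((G.restrict S).induce W).restrict F)) : ℝ) ≤
        (((hV1.toFinset \ X).card + (hV1.toFinset \ Y).card : ℕ) : ℝ) +
        2 * ((({e ∈ lightBoundary G F c (T ∩ X) | e ∈ S} : Finset β).card : ℝ) +
        (({e ∈ lightBoundary G F c (T ∩ Y) | e ∈ S} : Finset β).card : ℝ)) := by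
      exact_mod_cast hmatch.trans (Nat.add_le_add_left (Nat.mul_le_mul_left 2 hu) _)
    -- The factor 4: two copies of each edge, and one light boundary for each of `X` and `Y`.
    linarith
  · rintro e u v ⟨heF, ⟨heS, huv⟩, -, -⟩ hu hv
    rw [Finset.mem_union, Finset.mem_filter, Finset.mem_filter]
    rcases hT e u v huv with h | h
    -- Lightness is measured in `G`, but both `v` and `T ∩ X` lie in `W`, so all edges of `F`
    -- between them survive in the induced graph and the cut bound at `v` applies.
    · refine Or.inl ⟨Finset.mem_filter.2 ⟨heF, v, u, huv.symm, Finset.mem_inter.2 ⟨h, hu⟩,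
        hcY v hv _ fun f hf => ?_⟩, heS⟩
      obtain ⟨hf, w, hw, hlink⟩ := Finset.mem_filter.1 hf
      have hwX := (Finset.mem_inter.1 hw).2
      exact ⟨w, hwX, hf, hlink.symm, hXW w hwX, hYW v hv⟩
    · refine Or.inr ⟨Finset.mem_filter.2 ⟨heF, u, v, huv, Finset.mem_inter.2 ⟨h, hv⟩,
        hcX u hu _ fun f hf => ?_⟩, heS⟩
      obtain ⟨hf, w, hw, hlink⟩ := Finset.mem_filter.1 hf
      have hwY := (Finset.mem_inter.1 hw).2
      exact ⟨w, hwY, hf, hlink, hXW u hu, hYW w hwY⟩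

theorem alphaEps_nonneg (n : ℕ) (ε : ℝ) : 0 ≤ alphaEps n ε :=
  mul_nonneg (Real.log_natCast_nonneg n) (Real.rpow_nonneg zero_le_two _)

/-- The gap between sampling rate and capacity boost; it absorbs the Chernoff factor exp(16/ε). -/
theorem rhoEps_eq (n : ℕ) {ε : ℝ} (hε : 0 < ε) :
    rhoEps n ε = alphaEps n ε * (2 : ℝ) ^ (-(20 / ε ^ 2)) := by
  rw [rhoEps, alphaEps, mul_assoc, ← Real.rpow_add two_pos]
  congr 2
  field_simp
  norm_num

end CapMatching

/-! ### Union bound over subsets of the vertex cover -/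

theorem mainTheorem5 {α β Ω : Type*} (G : Graph α β) [G.Loopless]
    (hV : G.vertexSet.Finite) (hE : G.edgeSet.Finite)
    (ε : ℝ) (hε : 0 < ε) (hε' : ε < 1 / 2)
    (hμ : ε * (G.vertexSet.ncard : ℝ) / 16 ≤ (CapMatching.matchingNumber G : ℝ))
    (κ : β → ℝ) (hκ : ∀ e ∈ G.edgeSet, 0 ≤ κ e)
    [MeasurableSpace Ω] (P : Measure Ω) [IsProbabilityMeasure P] (S : Ω → Set β)
    (hS : CapMatching.IsIndepEdgeSample G
      (fun e => min 1 (κ e * CapMatching.rhoEps G.vertexSet.ncard ε)) P S) :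
    1 - Real.exp (-(CapMatching.matchingNumber G : ℝ)) ≤
      P.real {ω | ∀ W ⊆ G.vertexSet,
        (CapMatching.matchingNumber (CapMatching.doubleCover
            (((G.restrict (S ω)).induce W).restrict (CapMatching.lowEdges G κ ε))) : ℝ) ≤
          CapMatching.fractionalMatchingValue
              (CapMatching.doubleCover ((G.induce W).restrict (CapMatching.lowEdges G κ ε)))
              (CapMatching.doubleCoverCapacity (CapMatching.kappaPlus G κ ε)) +
            ε * (CapMatching.matchingNumber G : ℝ)} := by
  classical
  have hLfin : (CapMatching.lowEdges G κ ε).Finite := hE.subset fun e he => he.1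
  obtain ⟨F, hF⟩ := hLfin.exists_finset_coe
  obtain ⟨T, hTcard, hT⟩ := CapMatching.exists_vertex_cover G hE
  set c := CapMatching.kappaPlus G κ ε with hc
  set m := CapMatching.matchingNumber G
  set n := G.vertexSet.ncard
  have hFL : ∀ e ∈ F, e ∈ CapMatching.lowEdges G κ ε := fun e he => hF ▸ Finset.mem_coe.2 he
  have hFE : ∀ e ∈ F, e ∈ G.edgeSet := fun e he => (hFL e he).1
  have hcF : ∀ e ∈ F, c e = κ e * CapMatching.alphaEps n ε := fun e he => if_pos (hFL e he)
  have hc0 : ∀ e ∈ F, 0 ≤ c e := fun e he => by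
    rw [hcF e he]
    exact mul_nonneg (hκ e (hFE e he)) (CapMatching.alphaEps_nonneg _ _)
  have hn : (n : ℝ) ≤ 16 / ε * m := by
    rw [div_mul_eq_mul_div, le_div_iff₀ hε]
    linarith
  -- The threshold is a quarter of the allowed error, matching the `4 * b` in
  -- `matchingNumber_sample_le`.
  set bad : Finset α → Set Ω := fun Q =>
    {ω | ε * m / 4 ≤ (({e ∈ CapMatching.lightBoundary G F c Q | e ∈ S ω} : Finset β).card : ℝ)}
  have hbad : ∀ Q, P.real (bad Q) ≤ Real.exp (-(3 * m)) := by
    intro Q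
    have hsub : CapMatching.lightBoundary G F c Q ⊆ F := Finset.filter_subset _ _
    -- This `t` turns the threshold into the exponent -4m; the mean term gives back at most m.
    refine (hS.measure_le_card_le _ (fun e he => hFE e (hsub he)) (t := 16 / ε)
      (by positivity) _).trans (Real.exp_le_exp.2 ?_)
    have hp : ∑ e ∈ CapMatching.lightBoundary G F c Q, min 1 (κ e * CapMatching.rhoEps n ε) ≤
        (2 : ℝ) ^ (-(20 / ε ^ 2)) * (16 / ε * m) := by
      refine le_trans (Finset.sum_le_sum (g := fun e => (2 : ℝ) ^ (-(20 / ε ^ 2)) * c e)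
        fun e he => (min_le_right _ _).trans (le_of_eq ?_)) ?_
      · rw [hcF e (hsub he), CapMatching.rhoEps_eq n hε]
        ring
      · rw [← Finset.mul_sum]
        gcongr
        exact (CapMatching.sum_lightBoundary_le hV F c hc0 Q).trans hn
    have h1 : -(16 / ε) * (ε * m / 4) = -(4 * m) := by field_simp; ring
    have h2 : (Real.exp (16 / ε) - 1) *
        ∑ e ∈ CapMatching.lightBoundary G F c Q, min 1 (κ e * CapMatching.rhoEps n ε) ≤ m := by
      calc _ ≤ (Real.exp (16 / ε) - 1) * ((2 : ℝ) ^ (-(20 / ε ^ 2)) * (16 / ε * m)) :=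
            mul_le_mul_of_nonneg_left hp (sub_nonneg.2 (Real.one_le_exp (by positivity)))
        _ ≤ Real.exp (16 / ε) * ((2 : ℝ) ^ (-(20 / ε ^ 2)) * (16 / ε * m)) := by
            gcongr
            linarith
        _ = Real.exp (16 / ε) * (2 : ℝ) ^ (-(20 / ε ^ 2)) * (16 / ε) * m := by ring
        _ ≤ 1 * m := by
            gcongr
            exact CapMatching.union_bound_exponent hε hε'
        _ = m := one_mul _
    rw [h1]
    linarith
  have hunion : P.real (⋃ Q ∈ T.powerset, bad Q) ≤ Real.exp (-m) := by
    have h4 : ((2 : ℝ) ^ T.card) ≤ Real.exp (2 * m) := by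
      calc (2 : ℝ) ^ T.card ≤ 2 ^ (2 * m) := pow_le_pow_right₀ one_le_two hTcard
        _ ≤ Real.exp 1 ^ (2 * m) := by
            gcongr
            linarith [Real.add_one_le_exp 1]
        _ = Real.exp (2 * m) := by
            rw [← Real.exp_nat_mul]; push_cast; ring_nf
    calc _ ≤ ∑ Q ∈ T.powerset, P.real (bad Q) := measureReal_biUnion_finset_le _ _
      _ ≤ T.powerset.card • Real.exp (-(3 * m)) := Finset.sum_le_card_nsmul _ _ _ fun Q _ => hbad Q
      _ ≤ Real.exp (2 * m) * Real.exp (-(3 * m)) := by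
          rw [Finset.card_powerset, nsmul_eq_mul, Nat.cast_pow, Nat.cast_ofNat]
          gcongr
      _ = Real.exp (-m) := by rw [← Real.exp_add]; ring_nf
  set good := {ω | ∀ W ⊆ G.vertexSet,
        (CapMatching.matchingNumber (CapMatching.doubleCover
            (((G.restrict (S ω)).induce W).restrict (CapMatching.lowEdges G κ ε))) : ℝ) ≤
          CapMatching.fractionalMatchingValue
              (CapMatching.doubleCover ((G.induce W).restrict (CapMatching.lowEdges G κ ε)))
              (CapMatching.doubleCoverCapacity c) + ε * (m : ℝ)}
  have hcover : (Set.univ : Set Ω) ⊆ good ∪ ⋃ Q ∈ T.powerset, bad Q := by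
    intro ω _
    by_cases hω : ω ∈ ⋃ Q ∈ T.powerset, bad Q
    · exact Or.inr hω
    · refine Or.inl fun W hW => ?_
      simp only [Set.mem_iUnion, Finset.mem_powerset, not_exists, bad, Set.mem_ofPred_eq, not_le] at hω
      have := CapMatching.matchingNumber_sample_le hV F c hc0 T hT (S ω) (ε * m / 4)
        (fun Q hQ => (hω Q hQ).le) hW
      rw [hF] at this
      linarith
  -- Subadditivity of the outer measure suffices, so `good` need not be shown measurable.
  have h1 : (1 : ℝ) ≤ P.real good + P.real (⋃ Q ∈ T.powerset, bad Q) := by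
    rw [← probReal_univ (μ := P)]
    exact (measureReal_mono hcover).trans (measureReal_union_le _ _)
  linarith
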